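/- Let $k$ be an algebraically closed field and let $\mathcal C$ be a $k$-linear triangulated category with shift $\Sigma$ that is Hom-finite (all $\operatorname{Hom}_{\mathcal C}(X,Y)$ are finite-dimensional over $k$) and Krull–Schmidt (every object is a finite direct sum of objects with local endomorphism rings). Let $\mathcal S$ be a Serre functor on $\mathcal C$, that is, a self-equivalence of $\mathcal C$ together with isomorphisms $\operatorname{Hom}_k(\operatorname{Hom}_{\mathcal C}(X,Y),k)\cong\operatorname{Hom}_{\mathcal C}(Y,\mathcal S(X))$ natural in $X$ and $Y$. Let $F:\mathcal C\to\mathcal C$ be a $k$-linear endofunctor and let $\alpha:\mathrm{Id}_{\mathcal C}\to F$ be a natural transformation. Its support is the set of isomorphism classes of indecomposable objects $X$ with $\alpha_X\neq 0$. Suppose that the support of $\alpha$ consists of the isomorphism class of a single indecomposable object $M$, and that $F(M)$ is indecomposable. Then $F(M)\cong\mathcal S(M)$. If moreover there is no irreducible morphism $M\to M$, then $\alpha_M:M\to F(M)\cong\mathcal S(M)$ is almost vanishing. Here a morphism $f$ is irreducible if it is neither a split monomorphism nor a split epimorphism and, whenever $f=h\circ g$, either $g$ is a split monomorphism or $h$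 is a split epimorphism. An Auslander–Reiten triangle is a distinguished triangle $X\to Y\to Z\xrightarrow{\gamma}\Sigma X$ with $X$ and $Z$ indecomposable and $\gamma\ne0$, such that every morphism $W\to Z$ that is not a split epimorphism factors through $Y\to Z$. A morphism is almost vanishing if it is, up to an isomorphism of its codomain with $\Sigma X$, the third morphism $\gamma$ of an Auslander–Reiten triangle. -/

import Mathlib

open CategoryTheory CategoryTheory.Limits CategoryTheory.Pretriangulated

noncomputable section

namespace TriCat

universe w v u

/-- A `k`-linear category is Hom-finite if all its morphism spaces are finite dimensional. -/
class HomFinite (k : Type w) [Field k] (C : Type u) [Category.{v} C] [Preadditive C]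
    [Linear k C] : Prop where
  finite_hom : ∀ X Y : C, Module.Finite k (X ⟶ Y)

/-- An additive category is Krull-Schmidt if every object is a finite direct sum of objects
with local endomorphism rings. -/
class KrullSchmidt (C : Type u) [Category.{v} C] [Preadditive C] [HasFiniteBiproducts C] :
    Prop where
  exists_decomposition : ∀ X : C, ∃ (n : ℕ) (Y : Fin n → C),
    (∀ i, IsLocalRing (End (Y i))) ∧ Nonempty (X ≅ ⨁ Y)

/-- A Serre functor: a self-equivalence `S` together with `k`-linear isomorphisms
`D Hom(X, Y) ≅ Hom(Y, S X)`, natural in `X` and in `Y`, where `D` is the `k`-linear dual. -/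
structure SerreFunctor (k : Type w) [Field k] (C : Type u) [Category.{v} C] [Preadditive C]
    [Linear k C] where
  /-- the underlying functor -/
  functor : C ⥤ C
  isEquivalence : functor.IsEquivalence
  /-- the duality isomorphisms -/
  iso : ∀ X Y : C, Module.Dual k (X ⟶ Y) ≃ₗ[k] (Y ⟶ functor.obj X)
  iso_naturality_left : ∀ {X X' : C} (Y : C) (f : X ⟶ X') (φ : Module.Dual k (X ⟶ Y)),
    iso X' Y (φ.comp (Linear.leftComp k Y f)) = iso X Y φ ≫ functor.map f
  iso_naturality_right : ∀ (X : C) {Y Y' : C} (g : Y ⟶ Y') (φ : Module.Dual k (X ⟶ Y')),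
    iso X Y (φ.comp (Linear.rightComp k X g)) = g ≫ iso X Y' φ

/-- A morphism is irreducible if it is neither a split monomorphism nor a split epimorphism,
and in every factorization of it the first factor is a split monomorphism or the second factor
is a split epimorphism. -/
def IsIrreducibleMap {C : Type u} [Category.{v} C] {X Y : C} (f : X ⟶ Y) : Prop :=
  ¬ IsSplitMono f ∧ ¬ IsSplitEpi f ∧
    ∀ (Z : C) (g : X ⟶ Z) (h : Z ⟶ Y), g ≫ h = f → IsSplitMono g ∨ IsSplitEpi h

/-- The support of a natural transformation: the set of isomorphism classes of indecomposable
objects at which it is non-zero. -/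
def support {C : Type u} [Category.{v} C] [Preadditive C] [HasBinaryBiproducts C]
    {F G : C ⥤ C} (α : F ⟶ G) : Set (Quotient (isIsomorphicSetoid C)) :=
  {c | ∃ X : C, Indecomposable X ∧ α.app X ≠ 0 ∧ Quotient.mk (isIsomorphicSetoid C) X = c}

section Triangulated

variable {C : Type u} [Category.{v} C] [Preadditive C] [HasZeroObject C] [HasShift C ℤ]
  [∀ n : ℤ, (shiftFunctor C n).Additive] [Pretriangulated C]

/-- Auslander-Reiten triangles `X ⟶ Y ⟶ Z ⟶ X⟦1⟧`: distinguished triangles with indecomposable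
end terms and non-zero third morphism, such that every morphism to `Z` which is not a split
epimorphism factors through `Y ⟶ Z`. -/
structure IsAuslanderReitenTriangle (T : Triangle C) : Prop where
  distinguished : T ∈ distTriang C
  indecomposable₁ : Indecomposable T.obj₁
  indecomposable₃ : Indecomposable T.obj₃
  mor₃_ne_zero : T.mor₃ ≠ 0
  exists_lift : ∀ (W : C) (f : W ⟶ T.obj₃), ¬ IsSplitEpi f → ∃ g : W ⟶ T.obj₂, g ≫ T.mor₂ = f

/-- A morphism is almost vanishing if it is the third morphism of an Auslander-Reiten triangle
(its target being identified with the shift `X⟦1⟧` by some isomorphism). -/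
def IsAlmostVanishing {Z W : C} (γ : Z ⟶ W) : Prop :=
  ∃ (X Y : C) (a : X ⟶ Y) (b : Y ⟶ Z) (e : W ≅ X⟦(1 : ℤ)⟧),
    IsAuslanderReitenTriangle (Triangle.mk a b (γ ≫ e.hom))

end Triangulated

end TriCat

end

namespace TriCat

section SplitMorphisms

variable {C : Type*} [Category* C]

/-! Naturality forces an indecomposable `Y` with a map `Y ⟶ M` not killed by `α_M` to be isomorphic
to `M`. So a multiple of `α_M` is killed by all non-split-epis into `M` once radical endomorphisms
kill it, and finite-dimensionality of `Hom(M, F M)` gives such a nonzero multiple `β`. The nonzero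
map `γ : M ⟶ S M` from Serre duality is killed by every non-split-mono out of `S M`; as `β` factors
through `γ`, the second factor is a split mono into an indecomposable, hence an isomorphism.

For the second claim, `β` closes an Auslander–Reiten triangle `X ⟶ E ⟶ M`. If a radical endomorphism
did not kill `α_M`, neither would `E ⟶ M`, through which it factors; then a summand of `E` is a copy
of `M`, and its component `M ⟶ M` is irreducible. Otherwise `α_M` itself is killed by
non-split-epis, and its triangle is Auslander–Reiten. -/

theorem not_isIso_of_not_isSplitEpi {X Y : C} {f : X ⟶ Y} (hf : ¬ IsSplitEpi f)
    (g : Y ⟶ X) : ¬ IsIso (g ≫ f) := fun _ =>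
  hf ⟨⟨⟨inv (g ≫ f) ≫ g, by simp⟩⟩⟩

theorem not_isIso_of_not_isSplitMono {X Y : C} {f : X ⟶ Y} (hf : ¬ IsSplitMono f)
    (g : Y ⟶ X) : ¬ IsIso (f ≫ g) := fun _ =>
  hf ⟨⟨⟨g ≫ inv (f ≫ g), by rw [← Category.assoc, IsIso.hom_inv_id]⟩⟩⟩

end SplitMorphisms

section LocalEndomorphismRings

variable {C : Type*} [Category* C] [Preadditive C]

theorem isIso_or_isIso_of_add_eq_id {X : C} [IsLocalRing (End X)] {f g : X ⟶ X}
    (h : f + g = 𝟙 X) : IsIso f ∨ IsIso g := by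
  rw [← isUnit_iff_isIso, ← isUnit_iff_isIso]
  exact IsLocalRing.isUnit_or_isUnit_of_add_one (R := End X) h

theorem not_isZero_of_isLocalRing_end (X : C) [IsLocalRing (End X)] : ¬ IsZero X := fun h =>
  one_ne_zero (α := End X) (h.eq_of_src _ _)

theorem isIso_or_isIso_of_isIso_add {X : C} [IsLocalRing (End X)] {f g : X ⟶ X}
    (h : IsIso (f + g)) : IsIso f ∨ IsIso g := by
  have h1 : f ≫ inv (f + g) + g ≫ inv (f + g) = 𝟙 X := by
    rw [← Preadditive.add_comp, IsIso.hom_inv_id]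
  refine (isIso_or_isIso_of_add_eq_id h1).imp (fun _ => ?_) (fun _ => ?_)
  · rwa [← isIso_comp_right_iff f (inv (f + g))]
  · rwa [← isIso_comp_right_iff g (inv (f + g))]

/-- A non-zero retract of an object with local endomorphism ring is the whole object. -/
theorem isIso_of_comp_eq_id {X Y : C} [IsLocalRing (End Y)] (hX : ¬ IsZero X)
    {f : X ⟶ Y} {g : Y ⟶ X} (h : f ≫ g = 𝟙 X) : IsIso f := by
  have hp : (g ≫ f) ≫ (g ≫ f) = g ≫ f := by simp [reassoc_of% h]
  rcases isIso_or_isIso_of_add_eq_id (f := g ≫ f) (g := 𝟙 Y - g ≫ f) (by abel) with hi | hi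
  · refine ⟨g, h, ?_⟩
    rwa [← cancel_epi (g ≫ f), Category.comp_id]
  · have h0 : g ≫ f = 0 := by
      rw [← cancel_mono (𝟙 Y - g ≫ f)]
      simp [Preadditive.comp_sub, reassoc_of% h]
    refine absurd ((IsZero.iff_id_eq_zero X).2 ?_) hX
    calc 𝟙 X = f ≫ (g ≫ f) ≫ g := by simp [h]
      _ = 0 := by simp [h0]

theorem isIso_of_isSplitMono {X Y : C} [IsLocalRing (End Y)] (hX : ¬ IsZero X)
    (f : X ⟶ Y) [IsSplitMono f] : IsIso f :=
  isIso_of_comp_eq_id hX (IsSplitMono.id f)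

theorem isIso_of_isSplitEpi {X Y : C} [IsLocalRing (End X)] (hY : ¬ IsZero Y)
    (f : X ⟶ Y) [IsSplitEpi f] : IsIso f := by
  have := isIso_of_comp_eq_id hY (IsSplitEpi.id f)
  exact IsIso.of_isIso_fac_left (IsSplitEpi.id f)

variable (k : Type*) [Field k] [Linear k C]

/-- The non-isomorphisms in a local endomorphism ring. -/
def nonIsoSubmodule (X : C) [IsLocalRing (End X)] : Submodule k (X ⟶ X) where
  carrier := {f | ¬ IsIso f}
  zero_mem' := fun h => not_isZero_of_isLocalRing_end X
    ((IsZero.iff_id_eq_zero X).2 (by rw [← IsIso.hom_inv_id (0 : X ⟶ X), zero_comp]))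
  add_mem' := fun hf hg h => (isIso_or_isIso_of_isIso_add h).elim hf hg
  smul_mem' := fun c f hf h => hf (by
    refine isIso_of_comp_eq_id (not_isZero_of_isLocalRing_end X) (g := c • inv (c • f)) ?_
    rw [Linear.comp_smul, ← Linear.smul_comp, IsIso.hom_inv_id])

/-- A non-zero morphism out of an object with local endomorphism ring has a non-zero multiple
which is annihilated by all non-isomorphisms. -/
theorem exists_comp_ne_zero_annihilated [HomFinite k C] {X N : C} [IsLocalRing (End X)]
    {a : X ⟶ N} (ha : a ≠ 0) :
    ∃ f : X ⟶ X, f ≫ a ≠ 0 ∧ ∀ r : X ⟶ X, ¬ IsIso r → r ≫ f ≫ a = 0 := by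
  have := HomFinite.finite_hom (k := k) X N
  let V : (X ⟶ X) → Submodule k (X ⟶ N) := fun f => LinearMap.range (Linear.rightComp k X (f ≫ a))
  -- Minimality makes the cyclic submodule `End(X) · (f ≫ a)` simple, so the radical acts on it by
  -- zero.
  obtain ⟨W, ⟨f, hf, rfl⟩, hmin⟩ := (wellFounded_lt (α := Submodule k (X ⟶ N))).has_min
    (V '' {f | f ≫ a ≠ 0}) ⟨_, 𝟙 X, by simpa using ha, rfl⟩
  refine ⟨f, hf, fun r hr => ?_⟩
  by_contra hne
  have hle : V (r ≫ f) ≤ V f := by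
    rintro _ ⟨g, rfl⟩
    exact ⟨g ≫ r, by simp⟩
  have heq : V (r ≫ f) = V f := by
    by_contra h
    exact hmin _ ⟨r ≫ f, by simpa using hne, rfl⟩ (lt_of_le_of_ne hle h)
  obtain ⟨g, hg⟩ : f ≫ a ∈ V (r ≫ f) := heq ▸ ⟨𝟙 X, Category.id_comp _⟩
  -- A Nakayama argument: `𝟙 X - g ≫ r` kills `f ≫ a`, yet it is invertible unless `g ≫ r` is.
  rcases isIso_or_isIso_of_add_eq_id (f := g ≫ r) (g := 𝟙 X - g ≫ r) (by abel) with hi | hi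
  · have : IsSplitEpi r := ⟨⟨⟨inv (g ≫ r) ≫ g, by simp⟩⟩⟩
    exact hr (isIso_of_isSplitEpi (not_isZero_of_isLocalRing_end X) r)
  · refine hf ?_
    rw [← cancel_epi (𝟙 X - g ≫ r), comp_zero, Preadditive.sub_comp, Category.id_comp,
      sub_eq_zero]
    simpa using hg.symm

theorem indecomposable_of_isLocalRing_end [HasBinaryBiproducts C] (X : C)
    [IsLocalRing (End X)] : Indecomposable X := by
  refine ⟨not_isZero_of_isLocalRing_end X, fun Y Z i => ?_⟩
  by_contra! h
  have : IsIso (biprod.inl ≫ i.inv) := isIso_of_comp_eq_id h.1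
    (g := i.hom ≫ biprod.fst) (by simp)
  refine h.2 ((IsZero.iff_id_eq_zero Z).2 ?_)
  have h0 : i.hom ≫ (biprod.snd : Y ⊞ Z ⟶ Z) = 0 := by
    rw [← cancel_epi (biprod.inl ≫ i.inv)]; simp
  calc 𝟙 Z = biprod.inr ≫ i.inv ≫ i.hom ≫ biprod.snd := by simp
    _ = 0 := by simp [h0]

theorem isLocalRing_end_of_iso {X Y : C} (e : X ≅ Y) [IsLocalRing (End Y)] :
    IsLocalRing (End X) := by
  have : Nontrivial (End X) := ⟨1, 0, fun h => not_isZero_of_isLocalRing_end Y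
    (((IsZero.iff_id_eq_zero X).2 h).of_iso e.symm)⟩
  refine .of_isUnit_or_isUnit_one_sub_self fun a => ?_
  have key : (e.inv ≫ (show X ⟶ X from a) ≫ e.hom)
      + (e.inv ≫ (𝟙 X - (show X ⟶ X from a)) ≫ e.hom) = 𝟙 Y := by
    rw [← Preadditive.comp_add, ← Preadditive.add_comp]; simp
  refine (isIso_or_isIso_of_add_eq_id key).imp (fun h => ?_) (fun h => ?_) <;>
  · rw [isUnit_iff_isIso]
    rwa [isIso_comp_left_iff, isIso_comp_right_iff] at h

end LocalEndomorphismRings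

section Irreducible

variable {C : Type*} [Category* C] [Preadditive C]

/-- The components of a right minimal almost split morphism are irreducible. -/
theorem isIrreducibleMap_comp_of_rightMinimal {Y E M : C} {b : E ⟶ M} (hb : ¬ IsSplitEpi b)
    (hfac : ∀ (W : C) (f : W ⟶ M), ¬ IsSplitEpi f → ∃ g : W ⟶ E, g ≫ b = f)
    (hmin : ∀ e : E ⟶ E, e ≫ b = b → IsIso e) {i : Y ⟶ E} {p : E ⟶ Y} (hip : i ≫ p = 𝟙 Y)
    (hi : ¬ IsSplitMono (i ≫ b)) : IsIrreducibleMap (i ≫ b) := by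
  refine ⟨hi, fun h => hb ⟨⟨⟨section_ (i ≫ b) ≫ i, by simp⟩⟩⟩, fun Z g h hgh => ?_⟩
  by_contra! hn
  obtain ⟨h', rfl⟩ := hfac Z h hn.2
  -- This endomorphism replaces the inclusion `i` by `g ≫ h'` and fixes the complement of `Y`. It
  -- preserves `b`, so it is invertible, which exhibits `g` as a split mono.
  have := hmin (p ≫ g ≫ h' + (𝟙 E - p ≫ i)) (by
    simp [Preadditive.add_comp, Preadditive.sub_comp, hgh])
  refine hn.1 ⟨⟨⟨h' ≫ inv (p ≫ g ≫ h' + (𝟙 E - p ≫ i)) ≫ p, ?_⟩⟩⟩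
  have h1 : i ≫ (p ≫ g ≫ h' + (𝟙 E - p ≫ i)) = g ≫ h' := by
    simp [Preadditive.comp_add, Preadditive.comp_sub, reassoc_of% hip]
  rw [← reassoc_of% h1, IsIso.hom_inv_id_assoc, hip]

end Irreducible

section KrullSchmidt

variable {C : Type*} [Category* C] [Preadditive C] [HasFiniteBiproducts C]

/-- In a Krull-Schmidt category, a non-zero morphism restricts to a non-zero morphism on some
direct summand with local endomorphism ring. -/
theorem exists_summand_comp_ne_zero [KrullSchmidt C] {X N : C} {f : X ⟶ N} (hf : f ≠ 0) :
    ∃ (Y : C) (ι : Y ⟶ X) (π : X ⟶ Y), IsLocalRing (End Y) ∧ ι ≫ π = 𝟙 Y ∧ ι ≫ f ≠ 0 := by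
  obtain ⟨n, Y, hY, ⟨e⟩⟩ := KrullSchmidt.exists_decomposition X
  by_contra! h
  refine hf ?_
  rw [← cancel_epi e.inv, comp_zero]
  refine biproduct.hom_ext' _ _ fun i => ?_
  simpa using h (Y i) (biproduct.ι Y i ≫ e.inv) (e.hom ≫ biproduct.π Y i) (hY i) (by simp)

end KrullSchmidt

section SerreDuality

variable {k : Type*} [Field k] {C : Type*} [Category* C] [Preadditive C] [Linear k C]

/-- Serre duality provides a non-zero morphism `M ⟶ S M` annihilated by all radical morphisms. -/
theorem SerreFunctor.exists_socle (S : SerreFunctor k C) (M : C) [IsLocalRing (End M)] :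
    ∃ γ : M ⟶ S.functor.obj M, γ ≠ 0 ∧
      (∀ (W : C) (f : W ⟶ M), ¬ IsSplitEpi f → f ≫ γ = 0) ∧
      (∀ (Y : C) (g : S.functor.obj M ⟶ Y), ¬ IsSplitMono g → γ ≫ g = 0) := by
  have := S.isEquivalence
  -- A functional on `End(M)` vanishing on the radical but not at the identity; its Serre dual is
  -- the required map.
  obtain ⟨φ, hφ, hker⟩ := Submodule.exists_le_ker_of_notMem (p := nonIsoSubmodule k M)
    (v := 𝟙 M) (fun h => h inferInstance)
  refine ⟨S.iso M M φ, ?_, fun W f hf => ?_, fun Y g hg => ?_⟩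
  · rw [Ne, LinearEquiv.map_eq_zero_iff]
    rintro rfl
    exact hφ rfl
  · rw [← S.iso_naturality_right, LinearEquiv.map_eq_zero_iff]
    ext h
    exact hker (not_isIso_of_not_isSplitEpi hf h)
  · obtain ⟨g', hg'⟩ := S.functor.map_surjective (g ≫ (S.functor.objObjPreimageIso Y).inv)
    have hs : ¬ IsSplitMono g' := fun hs => hg (by
      have : g = S.functor.map g' ≫ (S.functor.objObjPreimageIso Y).hom := by simp [hg']
      rw [this]
      infer_instance)
    rw [← cancel_mono (S.functor.objObjPreimageIso Y).inv, Category.assoc, ← hg', zero_comp,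
      ← S.iso_naturality_left, LinearEquiv.map_eq_zero_iff]
    ext h
    exact hker (not_isIso_of_not_isSplitMono hs h)

end SerreDuality

section Triangulated

variable {C : Type*} [Category* C] [Preadditive C] [HasZeroObject C] [HasShift C ℤ]
  [∀ n : ℤ, (shiftFunctor C n).Additive] [Pretriangulated C]

/-- The triangle on a split mono splits, so the cone is a complement of `X` in `Y` and must vanish.
-/
theorem isIso_of_isSplitMono_of_indecomposable {X Y : C} (hY : Indecomposable Y)
    (hX : ¬ IsZero X) (f : X ⟶ Y) [IsSplitMono f] : IsIso f := by
  obtain ⟨Z, g, h, hT⟩ := distinguished_cocone_triangle f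
  have h0 : h = 0 := (Triangle.mor₃_eq_zero_iff_mono₁ _ hT).2 (inferInstanceAs (Mono f))
  obtain ⟨e, he⟩ : ∃ e : Y ≅ X ⊞ Z, f ≫ e.hom = biprod.inl :=
    (exists_iso_binaryBiproduct_of_distTriang _ hT h0).imp fun _ => And.left
  have hZ := (hY.2 _ _ e).resolve_left hX
  have hinl : IsIso (biprod.inl : X ⟶ X ⊞ Z) :=
    ⟨biprod.fst, by simp, biprod.hom_ext' _ _ (by simp) (hZ.eq_of_src _ _)⟩
  rwa [← he, isIso_comp_right_iff] at hinl

theorem isLocalRing_end_of_indecomposable [KrullSchmidt C] {X : C} (hX : Indecomposable X) :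
    IsLocalRing (End X) := by
  obtain ⟨Y, ι, π, hY, hι, -⟩ := exists_summand_comp_ne_zero (f := 𝟙 X)
    (fun h => hX.1 ((IsZero.iff_id_eq_zero X).2 h))
  have : IsSplitMono ι := ⟨⟨⟨π, hι⟩⟩⟩
  have := isIso_of_isSplitMono_of_indecomposable hX (not_isZero_of_isLocalRing_end Y) ι
  exact isLocalRing_end_of_iso (asIso ι).symm

theorem indecomposable_shift {X : C} (hX : Indecomposable X) (n : ℤ) :
    Indecomposable (X⟦n⟧) := by
  have hz : ∀ (m : ℤ) (Y : C), IsZero (Y⟦m⟧) → IsZero Y := fun m Y h => by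
    rw [IsZero.iff_id_eq_zero] at h ⊢
    exact (shiftFunctor C m).map_injective (by simpa using h)
  have hz' : ∀ (m : ℤ) (Y : C), IsZero Y → IsZero (Y⟦m⟧) := fun m Y h =>
    (shiftFunctor C m).map_isZero h
  refine ⟨fun h => hX.1 (hz n _ h), fun Y Z i => ?_⟩
  have := Limits.preservesBinaryBiproducts_of_preservesBiproducts (shiftFunctor C (-n))
  have j : X ≅ Y⟦-n⟧ ⊞ Z⟦-n⟧ := (shiftShiftNeg X n).symm ≪≫
    (shiftFunctor C (-n)).mapIso i ≪≫ (shiftFunctor C (-n)).mapBiprod Y Z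
  exact (hX.2 _ _ j).imp (hz _ _) (hz _ _)

/-- A socle morphism with indecomposable target is unique up to isomorphism of the target. -/
theorem exists_iso_of_annihilated {M N P : C} (hN : Indecomposable N) {γ : M ⟶ P} {β : M ⟶ N}
    (hγ : γ ≠ 0) (hγ' : ∀ (Y : C) (g : P ⟶ Y), ¬ IsSplitMono g → γ ≫ g = 0)
    (hβ : β ≠ 0) (hβ' : ∀ (W : C) (f : W ⟶ M), ¬ IsSplitEpi f → f ≫ β = 0) :
    ∃ e : P ≅ N, γ ≫ e.hom = β := by
  -- The fibre of `γ` maps to `M` by a non-split-epi since `γ ≠ 0`; `β` kills it and therefore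
  -- factors through `γ`.
  obtain ⟨E, f, h, hT⟩ := distinguished_cocone_triangle₁ γ
  have hf : f ≫ γ = 0 := comp_distTriang_mor_zero₁₂ _ hT
  have hfs : ¬ IsSplitEpi f := fun _ => hγ (by rwa [← cancel_epi f, comp_zero])
  obtain ⟨u, hu⟩ : ∃ u : P ⟶ N, β = γ ≫ u := Triangle.yoneda_exact₂ _ hT β (hβ' _ f hfs)
  have hus : IsSplitMono u := by
    by_contra hs
    exact hβ (hu.trans (hγ' _ u hs))
  have := isIso_of_isSplitMono_of_indecomposable hN (fun hP => hγ (hP.eq_of_tgt _ _)) u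
  exact ⟨asIso u, hu.symm⟩

/-- The second morphism of an Auslander-Reiten triangle is right minimal. -/
theorem isIso_of_comp_eq_mor₂ {X E M : C} {a : X ⟶ E} {b : E ⟶ M} {c : M ⟶ X⟦(1 : ℤ)⟧}
    (hT : Triangle.mk a b c ∈ distTriang C) (hX : Indecomposable (X⟦(1 : ℤ)⟧)) (hc : c ≠ 0)
    (hc' : ∀ (Y : C) (g : X⟦(1 : ℤ)⟧ ⟶ Y), ¬ IsSplitMono g → c ≫ g = 0)
    {e : E ⟶ E} (he : e ≫ b = b) : IsIso e := by
  have he' : b ≫ 𝟙 M = e ≫ b := by rw [he, Category.comp_id]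
  obtain ⟨w, hw₁, hw₂⟩ : ∃ w : X ⟶ X, a ≫ e = w ≫ a ∧ c ≫ w⟦(1 : ℤ)⟧' = 𝟙 M ≫ c :=
    complete_distinguished_triangle_morphism₁ _ _ hT hT e (𝟙 M) he'
  have hs : IsSplitMono (w⟦(1 : ℤ)⟧') := by
    by_contra hs
    -- If the shift of `w` were not a split mono, it would kill `c`, whereas it fixes `c`.
    exact hc ((Category.id_comp c).symm.trans (hw₂.symm.trans (hc' _ _ hs)))
  have := isIso_of_isSplitMono_of_indecomposable hX hX.1 (w⟦(1 : ℤ)⟧')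
  have : IsIso w := isIso_of_reflects_iso w (shiftFunctor C (1 : ℤ))
  let φ : Triangle.mk a b c ⟶ Triangle.mk a b c :=
    { hom₁ := w, hom₂ := e, hom₃ := 𝟙 M, comm₁ := hw₁, comm₂ := he', comm₃ := hw₂ }
  exact isIso₂_of_isIso₁₃ φ hT hT this (inferInstanceAs (IsIso (𝟙 M)))

/-- A non-zero morphism between indecomposable objects is almost vanishing if it is annihilated
by all morphisms to its source that are not split epimorphisms. -/
theorem isAlmostVanishing_of_annihilated {M N : C} (hM : Indecomposable M)
    (hN : Indecomposable N) {β : M ⟶ N} (hβ : β ≠ 0)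
    (hβ' : ∀ (W : C) (f : W ⟶ M), ¬ IsSplitEpi f → f ≫ β = 0) : IsAlmostVanishing β := by
  let e : N ≅ (N⟦(-1 : ℤ)⟧)⟦(1 : ℤ)⟧ := (shiftNegShift N (1 : ℤ)).symm
  obtain ⟨E, a, b, hT⟩ := distinguished_cocone_triangle₂ (β ≫ e.hom)
  refine ⟨_, E, a, b, e, hT, indecomposable_shift hN _, hM, ?_, fun W (f : W ⟶ M) hf => ?_⟩
  · exact fun h => hβ (by rw [← cancel_mono e.hom, zero_comp]; exact h)
  · obtain ⟨g, hg⟩ := Triangle.coyoneda_exact₃ _ hT f (by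
      exact (Category.assoc f β e.hom).symm.trans (by rw [hβ' W f hf, zero_comp]; rfl))
    exact ⟨g, hg.symm⟩

/-- By naturality `h ≫ α_M = α_Y ≫ F h`, so `Y` lies in the support. This is how the support
hypothesis enters. -/
theorem nonempty_iso_of_comp_app_ne_zero {F : C ⥤ C} {α : 𝟭 C ⟶ F} {M : C}
    (hα : support α = {Quotient.mk (isIsomorphicSetoid C) M}) {Y : C} [IsLocalRing (End Y)]
    {h : Y ⟶ M} (hh : h ≫ α.app M ≠ 0) : Nonempty (Y ≅ M) := by
  have hY : α.app Y ≠ 0 := fun h0 => hh (by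
    have := α.naturality h
    rw [h0, zero_comp] at this
    exact this)
  have hmem : Quotient.mk (isIsomorphicSetoid C) Y ∈ support α :=
    ⟨Y, indecomposable_of_isLocalRing_end Y, hY, rfl⟩
  rw [hα] at hmem
  exact Quotient.exact hmem

/-- If `α` is supported on `M`, then `f ≫ α.app M` is annihilated by all morphisms `W ⟶ M` that
are not split epimorphisms, once this holds for endomorphisms of `M`. -/
theorem comp_app_eq_zero_of_support [KrullSchmidt C] {F : C ⥤ C}
    {α : 𝟭 C ⟶ F} {M : C} (hα : support α = {Quotient.mk (isIsomorphicSetoid C) M}) {f : M ⟶ M}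
    (hf : ∀ r : M ⟶ M, ¬ IsIso r → r ≫ f ≫ α.app M = 0)
    (W : C) (h : W ⟶ M) (hh : ¬ IsSplitEpi h) : h ≫ f ≫ α.app M = 0 := by
  by_contra hne
  obtain ⟨Y, i, p, hY, -, hi⟩ := exists_summand_comp_ne_zero hne
  obtain ⟨e⟩ := nonempty_iso_of_comp_app_ne_zero hα (h := i ≫ h ≫ f) (by simpa using hi)
  have hr := hf (e.inv ≫ i ≫ h) (fun _ =>
    hh ⟨⟨⟨inv (e.inv ≫ i ≫ h) ≫ e.inv ≫ i, by simp⟩⟩⟩)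
  refine hi ?_
  rw [← cancel_epi e.inv, comp_zero]
  simpa using hr

/-- If `α` is supported on `M` and `M` admits no irreducible endomorphism, then `α.app M` is
annihilated by all non-isomorphisms `M ⟶ M`, provided some multiple `β` of it spans a socle. -/
theorem comp_app_eq_zero_of_not_irreducible [KrullSchmidt C] {F : C ⥤ C} {α : 𝟭 C ⟶ F} {M N : C}
    (hα : support α = {Quotient.mk (isIsomorphicSetoid C) M}) [IsLocalRing (End M)]
    (hirr : ¬ ∃ f : M ⟶ M, IsIrreducibleMap f) (hN : Indecomposable N) {β : M ⟶ N} (hβ : β ≠ 0)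
    (hβl : ∀ (W : C) (f : W ⟶ M), ¬ IsSplitEpi f → f ≫ β = 0)
    (hβr : ∀ (Y : C) (g : N ⟶ Y), ¬ IsSplitMono g → β ≫ g = 0)
    (r : M ⟶ M) (hr : ¬ IsIso r) : r ≫ α.app M = 0 := by
  have hM := not_isZero_of_isLocalRing_end M
  obtain ⟨X, E, a, b, e, hT⟩ := isAlmostVanishing_of_annihilated
    (indecomposable_of_isLocalRing_end M) hN hβ hβl
  have hX : Indecomposable (X⟦(1 : ℤ)⟧) := indecomposable_shift hT.indecomposable₁ 1
  have hb : ¬ IsSplitEpi b := fun _ => hT.mor₃_ne_zero (by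
    have h0 : b ≫ β ≫ e.hom = 0 := comp_distTriang_mor_zero₂₃ _ hT.distinguished
    change β ≫ e.hom = 0
    rwa [← cancel_epi b, comp_zero])
  have hmin : ∀ u : E ⟶ E, u ≫ b = b → IsIso u := fun u hu =>
    isIso_of_comp_eq_mor₂ hT.distinguished hX hT.mor₃_ne_zero (fun Y g hg => by
      rw [Category.assoc]
      refine hβr _ _ fun hs => hg ?_
      have : g = e.inv ≫ e.hom ≫ g := by simp
      rw [this]
      infer_instance) hu
  obtain ⟨g, rfl⟩ : ∃ g : M ⟶ E, g ≫ b = r := hT.exists_lift M r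
    (fun (_ : IsSplitEpi r) => hr (isIso_of_isSplitEpi hM r))
  by_contra hne
  have hbα : b ≫ α.app M ≠ 0 := fun h0 => hne (by rw [Category.assoc, h0, comp_zero])
  -- The summand of `E` detected by `α_M` is a copy of `M`; right minimality of `b` makes its
  -- component an irreducible endomorphism of `M`.
  obtain ⟨Y, i, p, hY, hip, hi⟩ := exists_summand_comp_ne_zero hbα
  obtain ⟨j⟩ := nonempty_iso_of_comp_app_ne_zero hα (h := i ≫ b) (by simpa using hi)
  refine hirr ⟨_, isIrreducibleMap_comp_of_rightMinimal hb hT.exists_lift hmin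
    (i := j.inv ≫ i) (p := p ≫ j.hom) (by simp [reassoc_of% hip]) fun _ => hb ?_⟩
  have := isIso_of_isSplitMono hM ((j.inv ≫ i) ≫ b)
  exact ⟨⟨⟨inv ((j.inv ≫ i) ≫ b) ≫ j.inv ≫ i, by simp⟩⟩⟩

end Triangulated

end TriCat

theorem mainTheorem2 {k : Type*} [Field k] [IsAlgClosed k]
    {C : Type*} [Category* C] [Preadditive C] [HasZeroObject C] [HasShift C ℤ]
    [∀ n : ℤ, (shiftFunctor C n).Additive] [Pretriangulated C] [IsTriangulated C]
    [Linear k C] [∀ n : ℤ, (shiftFunctor C n).Linear k]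
    [TriCat.HomFinite k C] [TriCat.KrullSchmidt C]
    (S : TriCat.SerreFunctor k C)
    (F : C ⥤ C) [F.Additive] [F.Linear k] (α : 𝟭 C ⟶ F)
    (M : C) (hM : Indecomposable M) (hFM : Indecomposable (F.obj M))
    (hα : TriCat.support α = {Quotient.mk (isIsomorphicSetoid C) M}) :
    Nonempty (F.obj M ≅ S.functor.obj M) ∧
      ((¬ ∃ f : M ⟶ M, TriCat.IsIrreducibleMap f) → TriCat.IsAlmostVanishing (α.app M)) := by
  have := TriCat.isLocalRing_end_of_indecomposable hM
  have hαM : α.app M ≠ 0 := by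
    obtain ⟨X, -, hX, hXM⟩ : Quotient.mk (isIsomorphicSetoid C) M ∈ TriCat.support α := by
      rw [hα]; rfl
    obtain ⟨e⟩ : Nonempty (X ≅ M) := Quotient.exact hXM
    refine fun h0 => hX ?_
    have hnat := α.naturality e.hom
    rw [h0, comp_zero] at hnat
    rw [← cancel_mono (F.map e.hom), zero_comp]
    exact hnat.symm
  obtain ⟨γ, hγ, -, hγr⟩ := S.exists_socle M
  obtain ⟨f, hf, hfr⟩ := TriCat.exists_comp_ne_zero_annihilated k (X := M) hαM
  have hfl := TriCat.comp_app_eq_zero_of_support hα hfr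
  obtain ⟨e, he⟩ := TriCat.exists_iso_of_annihilated hFM hγ hγr hf hfl
  refine ⟨⟨e.symm⟩, fun hirr => TriCat.isAlmostVanishing_of_annihilated hM hFM hαM ?_⟩
  -- The isomorphism `e` carries the annihilation property of `γ` over to `f ≫ α_M`.
  have hβr : ∀ (Y : C) (g : F.obj M ⟶ Y), ¬ IsSplitMono g → (f ≫ α.app M) ≫ g = 0 := by
    intro Y g hg
    rw [← he, Category.assoc]
    refine hγr _ _ fun hs => hg ?_
    have : g = e.inv ≫ e.hom ≫ g := by simp
    rw [this]
    infer_instance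
  have hrad := TriCat.comp_app_eq_zero_of_not_irreducible hα hirr hFM hf hfl hβr
  simpa using TriCat.comp_app_eq_zero_of_support hα (f := 𝟙 M) (by simpa using hrad)
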